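/- For a finite simple graph $G$ and an integer $\beta \ge 1$, a proper vertex colouring of $G$ is called $\beta$-frugal if every colour appears at most $\beta$ times in the neighbourhood of each vertex, and $\chi_\beta(G)$ denotes the minimum number of colours in a $\beta$-frugal colouring of $G$. Theorem. For every integer $\beta \ge 1$ there exists a constant $c_\beta > 0$, depending only on $\beta$, such that for all integers $\Delta \ge 2$ and $g \ge 3$ there exists a finite simple graph $G$ with maximum degree exactly $\Delta$ and girth (length of a shortest cycle) exactly $g$ such that \[\chi_\beta(G) \ge c_\beta \, \frac{\Delta^{1 + 1/\beta}}{(\log \Delta)^{1/\beta}},\] where $\log$ is the natural logarithm. -/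

import Mathlib

namespace SimpleGraph

/-- A proper colouring is `β`-frugal if every colour appears at most `β` times in the
neighbourhood of each vertex. -/
def Coloring.IsFrugal {V α : Type*} {G : SimpleGraph V} (C : G.Coloring α) (β : ℕ) : Prop :=
  ∀ (v : V) (a : α), {w : V | G.Adj v w ∧ C w = a}.encard ≤ β

/-- `G` has a `β`-frugal proper colouring with (at most) `k` colours. -/
def FrugalColorable {V : Type*} (G : SimpleGraph V) (β k : ℕ) : Prop :=
  ∃ C : G.Coloring (Fin k), C.IsFrugal β

/-- `χ_β(G)`, for a finite graph `G` and `β ≥ 1`: the minimum number of colours in a `β`-frugal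
colouring of `G`. -/
noncomputable def frugalChromaticNumber {V : Type*} [Finite V] (G : SimpleGraph V) (β : ℕ) : ℕ :=
  sInf {k : ℕ | G.FrugalColorable β k}

/-- The minimum defining `χ_β(G)` is taken over a non-empty set: the colouring with pairwise
distinct colours is `β`-frugal. -/
theorem exists_frugalColorable {V : Type*} [Finite V] (G : SimpleGraph V) {β : ℕ} (hβ : 1 ≤ β) :
    ∃ k, G.FrugalColorable β k := by
  obtain ⟨k, ⟨e⟩⟩ := Finite.exists_equiv_fin V
  refine ⟨k, Coloring.mk e fun {u v} h he => G.ne_of_adj h (e.injective he), fun v a => ?_⟩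
  refine le_trans (Set.encard_le_one_iff.2 ?_) (by exact_mod_cast hβ)
  rintro x y ⟨_, hx⟩ ⟨_, hy⟩
  exact e.injective (hx.trans hy.symm)

/-- The minimum defining `χ_β(G)` is attained. -/
theorem frugalColorable_frugalChromaticNumber {V : Type*} [Finite V] (G : SimpleGraph V) {β : ℕ}
    (hβ : 1 ≤ β) : G.FrugalColorable β (G.frugalChromaticNumber β) :=
  Nat.sInf_mem (G.exists_frugalColorable hβ)

end SimpleGraph

/-! The graph is the incidence graph of a family of sets `E x ⊆ α`, of maximum degree at most Δ and
girth at least g, in which every s-set of unsaturated elements (degree below Δ) meets some `E x` in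
more than β elements. Take |α| = 2ls and |ξ| = ls. Counting edges leaves at least ls unsaturated
elements, so with fewer than l colours some colour occupies s of them, and the vertex x given by
that s-set violates frugality. Hence χ_β ≥ l (`IsSparse.le_frugalChromaticNumber`).

The family is built one element at a time by conditional expectations. A new element of `E x` is
taken among the unsaturated ones at distance more than g from x, which keeps degrees and girth under
control. An s-set of unsaturated elements loses at most the ball of radius g, so at most M = (Δ+1)^g
elements; with s = 2M a uniform choice hits it with probability at least p = M/|α| = 1/(4l). Let q
be the probability of at least β+1 successes in Δ trials of probability p. Each x multiplies the
bound on the number of surviving s-sets by 1 - q (`exists_isSparse`), and none survives if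
C(2ls,s)(1-q)^(ls) < 1. For this log(2l) + 1 < lq suffices, a condition free of s and hence of g.
Since lq is at least of order Δ^(β+1)/l^β, one may take l of order (Δ^(β+1)/log Δ)^(1/β).

A disjoint cycle and a disjoint star make girth and maximum degree exact; small Δ are absorbed into
the constant. -/

open Finset

namespace SimpleGraph

/-! ### Girth under edge addition and disjoint union -/

section Girth

variable {V W : Type*} {G : SimpleGraph V} {H : SimpleGraph W}

/-- Adding an edge between two vertices that are far apart creates no short cycle. -/
theorem le_egirth_sup_edge {u v : V} {n : ℕ} (hG : (n : ℕ∞) ≤ G.egirth)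
    (huv : ∀ p : G.Walk v u, n ≤ p.length + 1) : (n : ℕ∞) ≤ (G ⊔ edge u v).egirth := by
  classical
  -- A cycle through the new edge leaves a walk from `v` to `u` avoiding that edge; such a walk
  -- lives in `G`.
  have key : ∀ q : (G ⊔ edge u v).Walk v u, s(u, v) ∉ q.edges → n ≤ q.length + 1 := by
    intro q hq
    have hq' : ∀ e ∈ q.edges, e ∈ G.edgeSet := by
      intro e he
      have h1 := q.edges_subset_edgeSet he
      rw [edgeSet_sup] at h1
      rcases h1 with h1 | h1
      · exact h1
      · exact absurd (Set.mem_singleton_iff.1 (edgeSet_edge_subset h1) ▸ he) hq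
    simpa using huv (q.transfer G hq')
  rw [le_egirth]
  intro a w hw
  rw [Nat.cast_le]
  by_cases he : s(u, v) ∈ w.edges
  · have hu : u ∈ w.support := w.fst_mem_support_of_mem_edges he
    have hw' := hw.rotate hu
    have he' : s(u, v) ∈ (w.rotate u hu).edges := (w.rotate_edges u hu).symm.mem_iff.1 he
    have hlen : (w.rotate u hu).length = w.length := by simp
    rw [← hlen]
    generalize w.rotate u hu = w' at hw' he'
    cases w' with
    | nil => exact absurd rfl hw'.ne_nil
    | @cons _ x _ h p =>
      rw [Walk.cons_isCycle_iff] at hw'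
      rw [Walk.length_cons]
      rw [Walk.edges_cons, List.mem_cons] at he'
      rcases he' with he' | he'
      · obtain rfl : v = x := by
          rcases Sym2.eq_iff.1 he' with h1 | h1
          · exact h1.2
          · rw [h1.2, ← h1.1]
        exact key p hw'.2
      -- The path `p` meets `u` only at its end, so the new edge is its last one. After reversal it
      -- comes first; the remainder, closed up by the edge from `x` to `u`, is the walk for `key`.
      · have hp := hw'.1.reverse
        have he2 : s(u, v) ∈ p.reverse.edges := by simpa using he'
        have hx : s(u, x) ∉ p.reverse.edges := by simpa using hw'.2
        rw [← Walk.length_reverse]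
        generalize p.reverse = r at hp he2 hx
        cases r with
        | nil => simp at he2
        | @cons _ y _ h' q =>
          rw [Walk.cons_isPath_iff] at hp
          have hnot : ∀ z, s(u, z) ∉ q.edges :=
            fun z hz => hp.2 (q.fst_mem_support_of_mem_edges hz)
          rw [Walk.edges_cons, List.mem_cons] at he2
          rcases he2 with he2 | he2
          · obtain rfl : v = y := by
              rcases Sym2.eq_iff.1 he2 with h1 | h1
              · exact h1.2
              · rw [h1.2, ← h1.1]
            have := key (q.concat h.symm) (by
              rw [Walk.edges_concat, List.concat_eq_append, List.mem_append, not_or]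
              refine ⟨hnot v, fun h2 => hx ?_⟩
              rw [List.mem_singleton, Sym2.eq_swap (a := x)] at h2
              rw [← h2]
              simp)
            simpa using this
          · exact absurd he2 (hnot v)
  · have hw' : ∀ e ∈ w.edges, e ∈ G.edgeSet := by
      intro e h
      have h1 := w.edges_subset_edgeSet h
      rw [edgeSet_sup] at h1
      rcases h1 with h1 | h1
      · exact h1
      · exact absurd (Set.mem_singleton_iff.1 (edgeSet_edge_subset h1) ▸ h) he
    have := hG.trans (egirth_le_length (hw.transfer hw'))
    simpa using this

/-- No edge joins the two summands. Supports and edges are recorded because being a cycle is read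
off from them. -/
theorem Walk.exists_of_sum_inl {x z : V ⊕ W} (p : (G ⊕g H).Walk x z) {u : V} (hx : x = .inl u) :
    ∃ v, z = .inl v ∧ ∃ q : G.Walk u v, q.support.map Sum.inl = p.support ∧
      q.edges.map (Sym2.map Sum.inl) = p.edges := by
  induction p generalizing u with
  | nil => subst hx; exact ⟨u, rfl, .nil, rfl, rfl⟩
  | @cons _ y _ h p ih =>
    subst hx
    rcases y with y | y
    · obtain ⟨v, rfl, q, hq, hq'⟩ := ih rfl
      refine ⟨v, rfl, .cons (by simpa using h) q, ?_, ?_⟩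
      · simp [hq]
      · simp [hq']
    · simp at h

theorem le_length_of_isCycle_sum_inl {u : V} {p : (G ⊕g H).Walk (.inl u) (.inl u)}
    (hp : p.IsCycle) : G.egirth ≤ p.length := by
  obtain ⟨v, hz, q, hq, hq'⟩ := p.exists_of_sum_inl rfl
  obtain rfl := Sum.inl_injective hz
  have hlen : q.length = p.length := by
    have := congrArg List.length hq
    simpa using this
  rw [Walk.isCycle_def, Walk.isTrail_def, ← hq, ← hq', ← List.map_tail] at hp
  rw [← hlen]
  refine egirth_le_length ((Walk.isCycle_def _).2 ⟨(Walk.isTrail_def _).2 hp.1.of_map, ?_,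
    hp.2.2.of_map⟩)
  rintro rfl
  exact hp.2.1 (Walk.length_eq_zero_iff.1 (by simpa using hlen.symm)).eq_nil

theorem egirth_sum : (G ⊕g H).egirth = min G.egirth H.egirth := by
  refine le_antisymm (le_min ?_ ?_) ?_
  · exact IsContained.egirth_le ⟨Embedding.sumInl.toCopy⟩
  · exact IsContained.egirth_le ⟨Embedding.sumInr.toCopy⟩
  · rw [le_egirth]
    rintro (a | a) w hw
    · exact (min_le_left _ _).trans (le_length_of_isCycle_sum_inl hw)
    · have := le_length_of_isCycle_sum_inl (hw.map (f := (Iso.sumComm (G := G) (H := H)).toHom)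
        (Iso.sumComm (G := G) (H := H)).injective)
      exact (min_le_right _ _).trans (this.trans_eq (congrArg _ (w.length_map _)))

theorem egirth_cycleGraph {n : ℕ} (hn : 3 ≤ n) : (cycleGraph n).egirth = n := by
  obtain ⟨n, rfl⟩ := Nat.exists_eq_add_of_le' hn
  refine le_antisymm ?_ ?_
  · simpa using egirth_le_length (cycleGraph.isCycle_cycle (n := n))
  · rw [le_egirth]
    intro a w hw
    -- A vertex of the cycle has two neighbours along it, which is already its full degree. By
    -- connectedness the cycle then visits every vertex.
    have hclosed : ∀ x y, (cycleGraph (n + 3)).Adj x y → x ∈ w.support → y ∈ w.support := by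
      intro x y hxy hx
      have h2 := hw.ncard_neighborSet_toSubgraph_eq_two hx
      have h3 : ((cycleGraph (n + 3)).neighborSet x).ncard = 2 := by
        rw [← cycleGraph_degree_three_le (v := x), ← card_neighborSet_eq_degree,
          Set.ncard_eq_toFinset_card', Set.toFinset_card]
      have h4 := Set.eq_of_subset_of_ncard_le (w.toSubgraph.neighborSet_subset x) (by omega)
      have : y ∈ w.toSubgraph.neighborSet x := by rw [h4]; exact hxy
      exact (w.mem_verts_toSubgraph).1 (w.toSubgraph.edge_vert this.symm)
    have hall : ∀ y, y ∈ w.support := by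
      intro y
      obtain ⟨p⟩ := cycleGraph_preconnected a y
      have : ∀ {x y} (p : (cycleGraph (n + 3)).Walk x y), x ∈ w.support → y ∈ w.support := by
        intro x y p
        induction p with
        | nil => exact id
        | cons h _ ih => exact fun hx => ih (hclosed _ _ h hx)
      exact this p w.start_mem_support
    have htail : ∀ y, y ∈ w.support.tail := by
      intro y
      rcases (w.mem_support_iff).1 (hall y) with rfl | h
      · exact w.end_mem_tail_support (fun h => hw.ne_nil h.eq_nil)
      · exact h
    have := Finset.card_le_card (s := (univ : Finset (Fin (n + 3)))) (t := w.support.tail.toFinset)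
      (fun y _ => by simpa using htail y)
    have h5 := this.trans (List.toFinset_card_le _)
    simp only [card_univ, Fintype.card_fin, List.length_tail, Walk.length_support] at h5
    exact_mod_cast h5

end Girth

/-- In a graph of maximum degree at most `d`, a ball of radius `k` has at most `(d + 1) ^ k`
vertices. -/
theorem ncard_setOf_walk_length_le {V : Type*} [Finite V] {G : SimpleGraph V} {d : ℕ}
    (hd : ∀ v, (G.neighborSet v).ncard ≤ d) (k : ℕ) (u : V) :
    {v | ∃ p : G.Walk u v, p.length ≤ k}.ncard ≤ (d + 1) ^ k := by
  classical
  have := Fintype.ofFinite V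
  induction k generalizing u with
  | zero =>
    have : {v | ∃ p : G.Walk u v, p.length ≤ 0} ⊆ {u} := by
      rintro v ⟨p, hp⟩
      exact (Walk.eq_of_length_eq_zero (Nat.le_zero.1 hp)).symm
    have h := Set.ncard_le_ncard this
    rwa [Set.ncard_singleton] at h
  | succ k ih =>
    have hsub : {v | ∃ p : G.Walk u v, p.length ≤ k + 1} ⊆
        insert u (⋃ w ∈ (G.neighborSet u).toFinset, {v | ∃ p : G.Walk w v, p.length ≤ k}) := by
      rintro v ⟨p, hp⟩
      cases p with
      | nil => exact Set.mem_insert _ _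
      | @cons _ w _ h p =>
        right
        simp only [Set.mem_toFinset, Set.mem_iUnion]
        exact ⟨w, h, p, by simpa using hp⟩
    have hU := Finset.set_ncard_biUnion_le (G.neighborSet u).toFinset
      (fun w => {v | ∃ p : G.Walk w v, p.length ≤ k})
    have hc : (G.neighborSet u).toFinset.card ≤ d := by
      rw [← Set.ncard_eq_toFinset_card']; exact hd u
    have h1 := Finset.sum_le_card_nsmul (G.neighborSet u).toFinset _ _ (fun w _ => ih w)
    have h2 : (G.neighborSet u).toFinset.card • (d + 1) ^ k ≤ d * (d + 1) ^ k := by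
      rw [smul_eq_mul]; exact Nat.mul_le_mul_right _ hc
    have h3 := (Set.ncard_le_ncard hsub).trans (Set.ncard_insert_le _ _)
    have h4 : 1 ≤ (d + 1) ^ k := Nat.one_le_pow _ _ (by omega)
    rw [pow_succ, mul_add, mul_comm ((d + 1) ^ k) d]
    omega

end SimpleGraph

/-! ### Binomial tails -/

/-- The probability that at least `j` among `r` independent trials of success probability `p`
succeed. -/
def binomialTail (p : ℝ) : ℕ → ℕ → ℝ
  | 0, _ => 1
  | _ + 1, 0 => 0
  | j + 1, r + 1 => p * binomialTail p j r + (1 - p) * binomialTail p (j + 1) r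

section BinomialTail

variable {p : ℝ}

@[simp] theorem binomialTail_zero_left (r : ℕ) : binomialTail p 0 r = 1 := by
  cases r <;> rfl

theorem binomialTail_le_one (h0 : 0 ≤ p) (h1 : p ≤ 1) (j r : ℕ) : binomialTail p j r ≤ 1 := by
  induction r generalizing j with
  | zero => cases j <;> simp [binomialTail]
  | succ r ih =>
    cases j with
    | zero => simp
    | succ j =>
      rw [binomialTail]
      nlinarith [ih j, ih (j + 1)]

theorem binomialTail_succ_le (h0 : 0 ≤ p) (h1 : p ≤ 1) (j r : ℕ) :
    binomialTail p (j + 1) r ≤ binomialTail p j r := by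
  induction r generalizing j with
  | zero => cases j <;> simp [binomialTail]
  | succ r ih =>
    cases j with
    | zero => rw [binomialTail_zero_left]; exact binomialTail_le_one h0 h1 _ _
    | succ j =>
      rw [binomialTail, binomialTail]
      nlinarith [ih j, ih (j + 1)]

/-- Keeps only the event of exactly `j` successes; the exponent `r` in place of `r - j` weakens the
bound but avoids subtraction. -/
theorem choose_mul_pow_mul_pow_le_binomialTail (h0 : 0 ≤ p) (h1 : p ≤ 1) (j r : ℕ) :
    r.choose j * p ^ j * (1 - p) ^ r ≤ binomialTail p j r := by
  induction r generalizing j with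
  | zero => cases j <;> simp [binomialTail]
  | succ r ih =>
    have hq : 0 ≤ 1 - p := by linarith
    cases j with
    | zero => simpa using pow_le_one₀ hq (by linarith : 1 - p ≤ 1)
    | succ j =>
      rw [binomialTail, Nat.choose_succ_succ]
      have e1 := mul_le_mul_of_nonneg_left (ih j) h0
      have e2 := mul_le_mul_of_nonneg_left (ih (j + 1)) hq
      have e3 : 0 ≤ r.choose j * p ^ (j + 1) * (1 - p) ^ r * p := by positivity
      push_cast
      calc _ = p * (r.choose j * p ^ j * (1 - p) ^ r) +
            (1 - p) * (r.choose (j + 1) * p ^ (j + 1) * (1 - p) ^ r) -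
            r.choose j * p ^ (j + 1) * (1 - p) ^ r * p := by ring
        _ ≤ _ := by linarith

end BinomialTail

/-! ### Incidence graphs and sparse families -/

namespace SimpleGraph

variable {α ξ : Type*}

/-- The bipartite incidence graph of a family of finite sets. -/
def incidence (E : ξ → Finset α) : SimpleGraph (α ⊕ ξ) where
  Adj
    | .inl a, .inr x => a ∈ E x
    | .inr x, .inl a => a ∈ E x
    | _, _ => False
  symm := ⟨by rintro (a | x) (b | y) h <;> exact h⟩
  loopless := ⟨by rintro (a | x) h <;> exact h⟩

variable {E : ξ → Finset α} {a b : α} {x y : ξ}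

@[simp] theorem incidence_adj_inl_inr : (incidence E).Adj (.inl a) (.inr x) ↔ a ∈ E x := Iff.rfl

@[simp] theorem incidence_adj_inr_inl : (incidence E).Adj (.inr x) (.inl a) ↔ a ∈ E x := Iff.rfl

@[simp] theorem not_incidence_adj_inl_inl : ¬ (incidence E).Adj (.inl a) (.inl b) := id

@[simp] theorem not_incidence_adj_inr_inr : ¬ (incidence E).Adj (.inr x) (.inr y) := id

theorem incidence_update_insert [DecidableEq α] [DecidableEq ξ] :
    incidence (Function.update E x (insert a (E x))) =
      incidence E ⊔ edge (.inr x) (.inl a) := by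
  ext u v
  rcases u with b | y <;> rcases v with c | z
  · simp [edge_adj]
  · by_cases h : z = x
    · subst h; simp [edge_adj, or_comm]
    · simp [edge_adj, h]
  · by_cases h : y = x
    · subst h; simp [edge_adj, or_comm]
    · simp [edge_adj, h]
  · simp [edge_adj]

theorem ncard_neighborSet_incidence_inr :
    ((incidence E).neighborSet (.inr x)).ncard = #(E x) := by
  have : (incidence E).neighborSet (.inr x) = Sum.inl '' (E x : Set α) := by
    ext (b | y) <;> simp
  rw [this, Set.ncard_image_of_injective _ Sum.inl_injective, Set.ncard_coe_finset]

/-- The averaging step: some `a ∈ U` does at least as well as a random trial. -/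
theorem exists_sum_one_sub_binomialTail_le [DecidableEq α] {p : ℝ} (h0 : 0 ≤ p) (h1 : p ≤ 1)
    {U : Finset α} (hU : U.Nonempty) (F : Finset (Finset α)) (hF : ∀ S ∈ F, p * #U ≤ #(U ∩ S))
    (j : Finset α → ℕ) (r : ℕ) :
    ∃ a ∈ U, ∑ S ∈ F, (1 - binomialTail p (j S - if a ∈ S then 1 else 0) r) ≤
      ∑ S ∈ F, (1 - binomialTail p (j S) (r + 1)) := by
  refine exists_le_of_sum_le hU ?_
  rw [sum_comm, sum_const, nsmul_eq_mul, mul_sum]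
  refine sum_le_sum fun S hS => ?_
  rcases hj : j S with _ | i
  · simp
  · have hsplit : ∑ a ∈ U, (1 - binomialTail p (i + 1 - if a ∈ S then 1 else 0) r) =
        #(U ∩ S) * (1 - binomialTail p i r) +
          (#U - #(U ∩ S)) * (1 - binomialTail p (i + 1) r) := by
      have hc := card_filter_add_card_filter_not (s := U) (· ∈ S)
      rw [filter_mem_eq_inter] at hc
      rw [← sum_filter_add_sum_filter_not U (· ∈ S),
        sum_congr rfl (g := fun _ => 1 - binomialTail p i r) (by
          intro a ha; simp [(mem_filter.1 ha).2]),
        sum_congr (s₁ := filter (fun a => ¬ a ∈ S) U) rfl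
          (g := fun _ => 1 - binomialTail p (i + 1) r) (by
          intro a ha; simp [(mem_filter.1 ha).2]),
        sum_const, sum_const, nsmul_eq_mul, nsmul_eq_mul, filter_mem_eq_inter]
      have : (#(filter (fun a => ¬ a ∈ S) U) : ℝ) = #U - #(U ∩ S) := by
        rw [← hc]; push_cast; ring
      rw [this]
    rw [hsplit, binomialTail]
    -- The two sides differ by (#(U ∩ S) - p #U)(T_i - T_(i+1)), where T_j is the tail with `r`
    -- trials.
    nlinarith [mul_nonneg (sub_nonneg.2 (hF S hS)) (sub_nonneg.2 (binomialTail_succ_le h0 h1 i r))]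

variable [Fintype ξ] [DecidableEq α]

/-- The number of members of the family `E` that contain `a`. -/
def setDegree (E : ξ → Finset α) (a : α) : ℕ := #{x | a ∈ E x}

theorem setDegree_mono {E E' : ξ → Finset α} (h : ∀ y, E y ⊆ E' y) (a : α) :
    setDegree E a ≤ setDegree E' a :=
  card_le_card fun _ hy => by
    simp only [mem_filter, mem_univ, true_and] at hy ⊢
    exact h _ hy

theorem ncard_neighborSet_incidence_inl :
    ((incidence E).neighborSet (.inl a)).ncard = setDegree E a := by
  have : (incidence E).neighborSet (.inl a) = Sum.inr '' {x | a ∈ E x} := by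
    ext (b | y) <;> simp
  rw [this, Set.ncard_image_of_injective _ Sum.inr_injective, setDegree,
    ← Set.ncard_coe_finset]
  simp

/-- The incidence graph of `E` has maximum degree at most `d` and girth at least `g`. -/
structure IsSparse (E : ξ → Finset α) (d g : ℕ) : Prop where
  setDegree_le (a : α) : setDegree E a ≤ d
  card_le (x : ξ) : #(E x) ≤ d
  le_egirth : (g : ℕ∞) ≤ (incidence E).egirth

/-- At most `Fintype.card ξ` elements are saturated. -/
theorem card_saturated_mul_le [Fintype α] {d : ℕ} (hE : ∀ x, #(E x) ≤ d) :
    #{a | d ≤ setDegree E a} * d ≤ Fintype.card ξ * d := by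
  have h1 : #{a | d ≤ setDegree E a} * d ≤ ∑ a, setDegree E a := by
    rw [← smul_eq_mul]
    refine (card_nsmul_le_sum _ _ _ fun a ha => (mem_filter.1 ha).2).trans
      (sum_le_sum_of_subset (filter_subset _ _))
  have h2 : ∑ a, setDegree E a = ∑ x, #(E x) := by
    have := sum_card_bipartiteAbove_eq_sum_card_bipartiteBelow
      (s := (univ : Finset α)) (t := (univ : Finset ξ)) (fun a x => a ∈ E x)
    simpa [bipartiteAbove, bipartiteBelow, setDegree] using this
  have h3 : ∑ x, #(E x) ≤ Fintype.card ξ * d := by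
    rw [← smul_eq_mul, ← card_univ]
    exact sum_le_card_nsmul _ _ _ fun x _ => hE x
  omega

/-- Vertices of `S` that are unsaturated and far from `x` make up most of `S`. -/
theorem card_le_card_filter_inter [Fintype α] {d g : ℕ} (hE : IsSparse E d g) (x : ξ) {S : Finset α}
    (hS : ∀ a ∈ S, setDegree E a < d) {U : Finset α}
    (hU : ∀ a, a ∈ U ↔ setDegree E a < d ∧
      ∀ p : (incidence E).Walk (.inr x) (.inl a), g < p.length) :
    #S ≤ #(U ∩ S) + (d + 1) ^ g := by
  have hball := ncard_setOf_walk_length_le (G := incidence E) (d := d) (by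
    rintro (a | y)
    · rw [ncard_neighborSet_incidence_inl]; exact hE.setDegree_le a
    · rw [ncard_neighborSet_incidence_inr]; exact hE.card_le y) g (.inr x)
  have hsub : Sum.inl '' ((S \ U : Finset α) : Set α) ⊆
      {v | ∃ p : (incidence E).Walk (.inr x) v, p.length ≤ g} := by
    rintro _ ⟨a, ha, rfl⟩
    simp only [coe_sdiff, Set.mem_sdiff, mem_coe, hU, not_and, not_forall, not_lt] at ha
    exact ha.2 (hS a ha.1)
  have h1 := Set.ncard_le_ncard hsub
  rw [Set.ncard_image_of_injective _ Sum.inl_injective, Set.ncard_coe_finset] at h1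
  have h2 := card_sdiff_add_card_inter S U
  rw [inter_comm] at h2
  omega

variable [DecidableEq ξ]

theorem setDegree_update_insert_le (b : α) :
    setDegree (Function.update E x (insert a (E x))) b ≤
      setDegree E b + if b = a then 1 else 0 := by
  unfold setDegree
  split_ifs with h
  · refine (card_le_card (t := insert x ({y | b ∈ E y} : Finset ξ)) ?_).trans (card_insert_le _ _)
    intro y
    by_cases hy : y = x <;> simp [hy]
  · refine card_le_card fun y => ?_
    by_cases hy : y = x
    · subst hy; simp [h]
    · simp [hy]

theorem IsSparse.update_insert {d g : ℕ} (hE : IsSparse E d g) (ha : setDegree E a < d)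
    (hx : #(E x) < d) (hfar : ∀ p : (incidence E).Walk (.inr x) (.inl a), g < p.length) :
    IsSparse (Function.update E x (insert a (E x))) d g where
  setDegree_le b := by
    have h1 := setDegree_update_insert_le (E := E) (x := x) (a := a) b
    have h2 := hE.setDegree_le b
    split_ifs at h1 with h
    · subst h; omega
    · omega
  card_le y := by
    by_cases hy : y = x
    · subst hy
      rw [Function.update_self]
      exact (card_insert_le _ _).trans hx
    · rw [Function.update_of_ne hy]
      exact hE.card_le y
  le_egirth := by
    rw [incidence_update_insert]
    refine le_egirth_sup_edge hE.le_egirth fun p => ?_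
    have := hfar p.reverse
    rw [Walk.length_reverse] at this
    omega

/-! ### Construction by conditional expectations -/

variable [Fintype α]

/-- Adding up to `r` elements to the set `E x` in such a way that few members of `F` remain alive,
where a set is alive if it has no saturated element and meets the new `E x` in at most `β`
elements. -/
theorem exists_extend_set {d g s β : ℕ} {p : ℝ} (h0 : 0 ≤ p) (h1 : p ≤ 1)
    (hg : 1 ≤ g) (hs : (d + 1) ^ g < s) (hp : p * Fintype.card α ≤ (s : ℝ) - ((d + 1) ^ g : ℕ))
    (x : ξ) (r : ℕ)
    {E : ξ → Finset α} (hE : IsSparse E d g) (hx : #(E x) + r ≤ d) (F : Finset (Finset α))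
    (hF : ∀ S ∈ F, #S = s ∧ ∀ a ∈ S, setDegree E a < d) :
    ∃ E' : ξ → Finset α, IsSparse E' d g ∧ (∀ y, y ≠ x → E' y = E y) ∧ (∀ y, E y ⊆ E' y) ∧
      (#{S ∈ F | (∀ a ∈ S, setDegree E' a < d) ∧ #(E' x ∩ S) ≤ β} : ℝ) ≤
        ∑ S ∈ F, (1 - binomialTail p (β + 1 - #(E x ∩ S)) r) := by
  induction r generalizing E F with
  | zero =>
    refine ⟨E, hE, fun _ _ => rfl, fun _ => Subset.rfl, ?_⟩
    rw [card_filter]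
    push_cast
    refine sum_le_sum fun S _ => ?_
    split_ifs with h
    -- A set still alive needs at least one more hit with no trials left, so its tail is 0 and it
    -- contributes exactly 1.
    · obtain ⟨i, hi⟩ : ∃ i, β + 1 - #(E x ∩ S) = i + 1 := ⟨β - #(E x ∩ S), by omega⟩
      simp [hi, binomialTail]
    · exact sub_nonneg.2 (binomialTail_le_one h0 h1 _ _)
  | succ r ih =>
    classical
    rcases F.eq_empty_or_nonempty with rfl | ⟨S₀, hS₀⟩
    · exact ⟨E, hE, fun _ _ => rfl, fun _ => Subset.rfl, by simp⟩
    obtain ⟨U, hU⟩ : ∃ U : Finset α, ∀ a, a ∈ U ↔ setDegree E a < d ∧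
        ∀ p : (incidence E).Walk (.inr x) (.inl a), g < p.length :=
      ⟨(Set.toFinite {a | _}).toFinset, fun a => by rw [Set.Finite.mem_toFinset]; rfl⟩
    have hlarge : ∀ S ∈ F, s ≤ #(U ∩ S) + (d + 1) ^ g := fun S hS =>
      (hF S hS).1 ▸ card_le_card_filter_inter hE x (hF S hS).2 hU
    have hUne : U.Nonempty := by
      have := hlarge S₀ hS₀
      exact (card_pos.1 (by omega : 0 < #(U ∩ S₀))).mono inter_subset_left
    obtain ⟨a, haU, ha⟩ := exists_sum_one_sub_binomialTail_le h0 h1 hUne F (by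
      intro S hS
      have e1 : (s : ℝ) ≤ #(U ∩ S) + ((d + 1) ^ g : ℕ) := by exact_mod_cast hlarge S hS
      have e2 : p * #U ≤ p * Fintype.card α :=
        mul_le_mul_of_nonneg_left (by exact_mod_cast card_le_univ U) h0
      linarith) (fun S => β + 1 - #(E x ∩ S)) r
    obtain ⟨had, hafar⟩ := (hU a).1 haU
    -- Membership would give a walk of length one, excluded by `1 ≤ g`. Thus a hit really raises the
    -- intersection size.
    have haE : a ∉ E x := by
      intro h
      have := hafar (Walk.cons (incidence_adj_inr_inl.2 h) Walk.nil)
      rw [Walk.length_cons, Walk.length_nil] at this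
      omega
    set E₁ := Function.update E x (insert a (E x)) with hE₁
    have hE₁x : E₁ x = insert a (E x) := Function.update_self ..
    have hE₁y : ∀ y, y ≠ x → E₁ y = E y := fun y hy => Function.update_of_ne hy ..
    have hmono : ∀ y, E y ⊆ E₁ y := by
      intro y
      by_cases hy : y = x
      · subst hy; rw [hE₁x]; exact subset_insert _ _
      · rw [hE₁y y hy]
    obtain ⟨E', hE', hne, hsub, hle⟩ := ih (E := E₁)
      (hE.update_insert had (by omega) hafar)
      (by rw [hE₁x]; have := card_insert_le a (E x); omega)
      ({S ∈ F | ∀ a ∈ S, setDegree E₁ a < d})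
      (fun S hS => ⟨(hF S (mem_filter.1 hS).1).1, (mem_filter.1 hS).2⟩)
    refine ⟨E', hE', fun y hy => (hne y hy).trans (hE₁y y hy),
      fun y => (hmono y).trans (hsub y), ?_⟩
    refine le_trans ?_ (hle.trans (le_trans ?_ ha))
    · refine Nat.cast_le.2 (card_le_card fun S hS => ?_)
      simp only [mem_filter] at hS ⊢
      exact ⟨⟨hS.1, fun b hb => (setDegree_mono hsub b).trans_lt (hS.2.1 b hb)⟩, hS.2⟩
    -- Sets containing a newly saturated element are dropped, which only lowers the sum of
    -- nonnegative terms.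
    · refine (sum_le_sum_of_subset_of_nonneg (filter_subset _ _) fun S _ _ =>
        sub_nonneg.2 (binomialTail_le_one h0 h1 _ _)).trans_eq (sum_congr rfl fun S _ => ?_)
      rw [hE₁x]
      by_cases haS : a ∈ S
      · rw [insert_inter_of_mem haS, card_insert_of_notMem (by simp [haE]), if_pos haS, Nat.sub_sub]
      · rw [insert_inter_of_notMem haS, if_neg haS, Nat.sub_zero]

/-- A sparse family of sets such that the number of `s`-sets of unsaturated elements meeting no
member of the family in more than `β` elements is small. -/
theorem exists_isSparse {d g s β : ℕ} {p : ℝ} (h0 : 0 ≤ p) (h1 : p ≤ 1)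
    (hg : 1 ≤ g) (hs : (d + 1) ^ g < s) (hp : p * Fintype.card α ≤ (s : ℝ) - ((d + 1) ^ g : ℕ))
    (Y : Finset ξ) :
    ∃ E : ξ → Finset α, IsSparse E d g ∧ (∀ y, y ∉ Y → E y = ∅) ∧
      (#{S ∈ powersetCard s (univ : Finset α) | (∀ a ∈ S, setDegree E a < d) ∧
          ∀ y ∈ Y, #(E y ∩ S) ≤ β} : ℝ) ≤
        (Fintype.card α).choose s * (1 - binomialTail p (β + 1) d) ^ #Y := by
  induction Y using Finset.induction_on with
  | empty =>
    refine ⟨fun _ => ∅, ⟨fun a => by simp [setDegree], fun x => by simp, ?_⟩, fun _ _ => rfl, ?_⟩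
    · have : incidence (fun _ : ξ => (∅ : Finset α)) = ⊥ := by
        ext (a | x) (b | y) <;> simp
      simp [this]
    · rw [card_empty, pow_zero, mul_one]
      refine Nat.cast_le.2 ((card_filter_le _ _).trans_eq ?_)
      simp
  | insert x Y hxY ih =>
    obtain ⟨E, hE, hempty, hle⟩ := ih
    obtain ⟨E', hE', hne, hsub, hle'⟩ := exists_extend_set (β := β) h0 h1 hg hs hp x d hE
      (by simp [hempty x hxY])
      ({S ∈ powersetCard s (univ : Finset α) | (∀ a ∈ S, setDegree E a < d) ∧
          ∀ y ∈ Y, #(E y ∩ S) ≤ β}) (fun S hS => by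
        simp only [mem_filter, mem_powersetCard] at hS
        exact ⟨hS.1.2, hS.2.1⟩)
    have hYx : ∀ y ∈ Y, y ≠ x := fun y hy h => hxY (h ▸ hy)
    refine ⟨E', hE', fun y hy => ?_, ?_⟩
    · rw [mem_insert, not_or] at hy
      rw [hne y hy.1, hempty y hy.2]
    · refine le_trans ?_ (hle'.trans ?_)
      · refine Nat.cast_le.2 (card_le_card fun S hS => ?_)
        simp only [mem_filter, mem_insert, forall_eq_or_imp] at hS ⊢
        refine ⟨⟨hS.1, fun b hb => (setDegree_mono hsub b).trans_lt (hS.2.1 b hb),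
          fun y hy => ?_⟩, hS.2.1, hS.2.2.1⟩
        rw [← hne y (hYx y hy)]
        exact hS.2.2.2 y hy
      · simp only [hempty x hxY, empty_inter, card_empty, Nat.sub_zero, sum_const, nsmul_eq_mul]
        rw [card_insert_of_notMem hxY, pow_succ, ← mul_assoc]
        exact mul_le_mul_of_nonneg_right hle (sub_nonneg.2 (binomialTail_le_one h0 h1 _ _))

theorem exists_isSparse_forall_lt_card_inter {d g s β : ℕ} {p : ℝ} (h0 : 0 ≤ p) (h1 : p ≤ 1)
    (hg : 1 ≤ g) (hs : (d + 1) ^ g < s)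
    (hp : p * Fintype.card α ≤ (s : ℝ) - ((d + 1) ^ g : ℕ))
    (hlt : (Fintype.card α).choose s * (1 - binomialTail p (β + 1) d) ^ Fintype.card ξ < 1) :
    ∃ E : ξ → Finset α, IsSparse E d g ∧
      ∀ S : Finset α, #S = s → (∀ a ∈ S, setDegree E a < d) → ∃ x, β < #(E x ∩ S) := by
  obtain ⟨E, hE, -, hcard⟩ := exists_isSparse (β := β) h0 h1 hg hs hp (univ : Finset ξ)
  have hlt' := hcard.trans_lt hlt
  rw [Nat.cast_lt_one, card_eq_zero, eq_empty_iff_forall_notMem] at hlt'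
  refine ⟨E, hE, fun S hS hunsat => ?_⟩
  by_contra! hcon
  exact hlt' S (mem_filter.2 ⟨mem_powersetCard.2 ⟨subset_univ S, hS⟩, hunsat, fun y _ => hcon y⟩)

end SimpleGraph

/-! ### Numerical estimates -/

/-- The binomial coefficient is at most (2le)^s and 1 - q ≤ e^(-q), so the product is at most an
s-th power whose base does not involve s. -/
theorem choose_mul_one_sub_pow_lt_one {l s : ℕ} (hl : 1 ≤ l) (hs : 1 ≤ s) {q : ℝ} (hq : q ≤ 1)
    (h : Real.log (2 * l) + 1 < l * q) :
    ((2 * l * s).choose s : ℝ) * (1 - q) ^ (l * s) < 1 := by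
  have hl' : (0 : ℝ) < 2 * l := by positivity
  have hs' : (0 : ℝ) < s := by positivity
  have h1 : ((2 * l * s).choose s : ℝ) ≤ Real.exp (s * (Real.log (2 * l) + 1)) := by
    calc ((2 * l * s).choose s : ℝ) ≤ ((2 * l * s : ℕ) : ℝ) ^ s / s.factorial :=
          Nat.choose_le_pow_div _ _
      _ = (2 * l : ℝ) ^ s * ((s : ℝ) ^ s / s.factorial) := by push_cast; ring
      _ ≤ (2 * l : ℝ) ^ s * Real.exp s :=
          mul_le_mul_of_nonneg_left (Real.pow_div_factorial_le_exp _ hs'.le _) (by positivity)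
      _ = Real.exp (s * (Real.log (2 * l) + 1)) := by
          rw [mul_add, Real.exp_add, mul_one, Real.exp_nat_mul, Real.exp_log hl']
  have h2 : (1 - q) ^ (l * s) ≤ Real.exp (-(s * (l * q))) := by
    calc (1 - q) ^ (l * s) ≤ Real.exp (-q) ^ (l * s) :=
          pow_le_pow_left₀ (by linarith) (by linarith [Real.add_one_le_exp (-q)]) _
      _ = Real.exp (-(s * (l * q))) := by
          rw [← Real.exp_nat_mul]; push_cast; congr 1; ring
  calc _ ≤ Real.exp (s * (Real.log (2 * l) + 1)) * Real.exp (-(s * (l * q))) :=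
        mul_le_mul h1 h2 (pow_nonneg (by linarith) _) (Real.exp_nonneg _)
    _ = Real.exp (s * (Real.log (2 * l) + 1 - l * q)) := by rw [← Real.exp_add]; congr 1; ring
    _ < 1 := by
        rw [Real.exp_lt_one_iff]
        exact mul_neg_of_pos_of_neg hs' (by linarith)

/-- Here C(d, β+1) ≥ (d/2)^(β+1)/(β+1)!, and Bernoulli gives (1-p)^d ≥ 1/2. The 8 is this 2 times
the 4 of p = 1/(4l). -/
theorem le_mul_binomialTail {β d l : ℕ} (hd : 2 * β ≤ d) (hl : d ≤ l) (hl1 : 1 ≤ l) :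
    (2 * 8 ^ (β + 1) * (β + 1).factorial : ℝ)⁻¹ * d ^ (β + 1) / l ^ β ≤
      l * binomialTail (1 / (4 * l)) (β + 1) d := by
  have hl0 : (0 : ℝ) < l := by exact_mod_cast hl1
  have hl1' : (1 : ℝ) ≤ l := by exact_mod_cast hl1
  have hp0 : (0 : ℝ) ≤ 1 / (4 * l) := by positivity
  have hp1 : 1 / (4 * l : ℝ) ≤ 1 := by
    rw [div_le_one (by positivity)]; linarith
  have hbern : (1 / 2 : ℝ) ≤ (1 - 1 / (4 * l)) ^ d := by
    have h1 := one_add_mul_le_pow (a := -(1 / (4 * l : ℝ))) (by linarith) d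
    have h2 : (d : ℝ) * (1 / (4 * l)) ≤ 1 / 4 := by
      rw [mul_one_div, div_le_iff₀ (by positivity)]
      have : (d : ℝ) ≤ l := by exact_mod_cast hl
      linarith
    rw [← sub_eq_add_neg] at h1
    linarith
  have hchoose : ((d : ℝ) / 2) ^ (β + 1) / (β + 1).factorial ≤ d.choose (β + 1) := by
    refine le_trans ?_ (Nat.pow_le_choose (β + 1) d)
    gcongr
    rw [div_le_iff₀ two_pos]
    exact_mod_cast (by omega : d ≤ (d + 1 - (β + 1)) * 2)
  have hmain := choose_mul_pow_mul_pow_le_binomialTail hp0 hp1 (β + 1) d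
  calc (2 * 8 ^ (β + 1) * (β + 1).factorial : ℝ)⁻¹ * d ^ (β + 1) / l ^ β
      = l * (((d : ℝ) / 2) ^ (β + 1) / (β + 1).factorial * (1 / (4 * l)) ^ (β + 1) * (1 / 2)) := by
        have : (8 : ℝ) ^ (β + 1) = 2 ^ (β + 1) * 4 ^ (β + 1) := by rw [← mul_pow]; norm_num
        rw [this, div_pow, div_pow, mul_pow, one_pow, pow_succ (l : ℝ)]
        field_simp
    _ ≤ l * (d.choose (β + 1) * (1 / (4 * l)) ^ (β + 1) * (1 - 1 / (4 * l)) ^ d) := by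
        gcongr
    _ ≤ _ := mul_le_mul_of_nonneg_left hmain hl0.le

/-- With R^β = d^(β+1)/log d and l = ⌈KR/16⌉, the left side is at most 3 log d and the right side at
least 8 log d. -/
theorem exists_log_lt_mul_binomialTail {β : ℕ} (hβ : 1 ≤ β) :
    ∃ c : ℝ, 0 < c ∧ ∃ d₀ : ℕ, ∀ d : ℕ, d₀ ≤ d → ∃ l : ℕ, 1 ≤ l ∧
      c * ((d : ℝ) ^ (1 + 1 / (β : ℝ)) / (Real.log d) ^ (1 / (β : ℝ))) ≤ l ∧
      Real.log (2 * l) + 1 < l * binomialTail (1 / (4 * l)) (β + 1) d := by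
  obtain ⟨K, hK⟩ : ∃ K : ℝ, K = (2 * 8 ^ (β + 1) * (β + 1).factorial : ℝ)⁻¹ := ⟨_, rfl⟩
  have hK0 : 0 < K := by rw [hK]; positivity
  have hK1 : K ≤ 1 := by
    rw [hK]
    refine inv_le_one_of_one_le₀ ?_
    have h1 : (1 : ℝ) ≤ 8 ^ (β + 1) := one_le_pow₀ (by norm_num)
    have h2 : (1 : ℝ) ≤ (β + 1).factorial := by exact_mod_cast Nat.factorial_pos _
    nlinarith
  have hβ0 : (β : ℝ) ≠ 0 := by positivity
  have hβ1 : (1 : ℝ) ≤ β := by exact_mod_cast hβ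
  have hlim : ∀ᶠ d : ℕ in Filter.atTop, Real.log d ≤ (K / 16) ^ β * d := by
    have h := (Real.isLittleO_log_id_atTop.bound (show (0 : ℝ) < (K / 16) ^ β by positivity))
    filter_upwards [tendsto_natCast_atTop_atTop.eventually h] with d hd
    refine (le_abs_self _).trans ?_
    simpa using hd
  obtain ⟨d₀, hd₀⟩ := Filter.eventually_atTop.1 hlim
  refine ⟨K / 16, by positivity, max d₀ (max 3 (2 * β)), fun d hd => ?_⟩
  simp only [max_le_iff] at hd
  have hlogd := hd₀ d hd.1
  have hd3 : (3 : ℝ) ≤ d := by exact_mod_cast hd.2.1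
  have hd0 : (0 : ℝ) < d := by linarith
  have hlog1 : 1 ≤ Real.log d := by
    rw [Real.le_log_iff_exp_le hd0]
    linarith [Real.exp_one_lt_d9]
  obtain ⟨R, hR⟩ : ∃ R : ℝ, R = (d : ℝ) ^ (1 + 1 / (β : ℝ)) / (Real.log d) ^ (1 / (β : ℝ)) :=
    ⟨_, rfl⟩
  have hR0 : 0 < R := by rw [hR]; positivity
  have hRβ : R ^ β = d ^ (β + 1) / Real.log d := by
    rw [hR, div_pow, ← Real.rpow_natCast, ← Real.rpow_natCast, ← Real.rpow_mul hd0.le,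
      ← Real.rpow_mul (by linarith), one_div, inv_mul_cancel₀ hβ0, Real.rpow_one, add_mul,
      inv_mul_cancel₀ hβ0, one_mul, ← Real.rpow_natCast]
    push_cast
    rfl
  have hRd : R ≤ (d : ℝ) ^ 2 := by
    rw [hR]
    refine (div_le_self (by positivity) (Real.one_le_rpow hlog1 (by positivity))).trans ?_
    rw [← Real.rpow_natCast]
    refine Real.rpow_le_rpow_of_exponent_le (by linarith) ?_
    have : 1 / (β : ℝ) ≤ 1 := by rw [div_le_one (by positivity)]; exact hβ1
    push_cast
    linarith
  -- Gives `d ≤ l`, and KR/16 ≥ 1, so rounding up at most doubles: l ≤ KR/8.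
  have hcR : (d : ℝ) ≤ K / 16 * R := by
    refine le_of_pow_le_pow_left₀ (n := β) (by omega) (by positivity) ?_
    rw [mul_pow, hRβ, pow_succ, ← mul_div_assoc, le_div_iff₀ (by linarith)]
    have := mul_le_mul_of_nonneg_left hlogd (show (0 : ℝ) ≤ (d : ℝ) ^ β by positivity)
    linarith
  rw [← hR]
  obtain ⟨l, hl⟩ : ∃ l : ℕ, l = ⌈K / 16 * R⌉₊ := ⟨_, rfl⟩
  have hle : K / 16 * R ≤ l := hl ▸ Nat.le_ceil _
  have hlt : (l : ℝ) < K / 16 * R + 1 := hl ▸ Nat.ceil_lt_add_one (by positivity)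
  have hl2 : (l : ℝ) ≤ K / 8 * R := by linarith
  have hdl : d ≤ l := by exact_mod_cast hcR.trans hle
  have hl1 : 1 ≤ l := by omega
  have hl0 : (0 : ℝ) < l := by exact_mod_cast hl1
  refine ⟨l, hl1, hle, lt_of_lt_of_le ?_ (le_mul_binomialTail hd.2.2 hdl hl1)⟩
  rw [← hK]
  have hleft : Real.log (2 * l) + 1 ≤ 3 * Real.log d := by
    have h1 : Real.log (2 * l) ≤ Real.log ((d : ℝ) ^ 2) := by
      refine Real.log_le_log (by positivity) ?_
      nlinarith
    rw [Real.log_pow] at h1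
    push_cast at h1
    linarith
  have hlβ : (l : ℝ) ^ β ≤ K / 8 * (d ^ (β + 1) / Real.log d) := by
    calc (l : ℝ) ^ β ≤ (K / 8 * R) ^ β := pow_le_pow_left₀ hl0.le hl2 _
      _ = (K / 8) ^ β * (d ^ (β + 1) / Real.log d) := by rw [mul_pow, hRβ]
      _ ≤ _ := by
        gcongr
        exact pow_le_of_le_one (by positivity) (by linarith) (by omega)
  have hright : 8 * Real.log d ≤ K * d ^ (β + 1) / l ^ β := by
    rw [le_div_iff₀ (by positivity)]
    calc _ ≤ 8 * Real.log d * (K / 8 * (d ^ (β + 1) / Real.log d)) := by gcongr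
      _ = K * d ^ (β + 1) := by field_simp
  linarith

namespace SimpleGraph

theorem degree_eq_ncard_neighborSet {V : Type*} (G : SimpleGraph V) (v : V)
    [Fintype (G.neighborSet v)] : G.degree v = (G.neighborSet v).ncard := by
  rw [← card_neighborSet_eq_degree, Set.ncard_eq_toFinset_card', Set.toFinset_card]

/-! ### Exact girth and degree, and the colouring bound -/

section Padding

variable {α ξ : Type*}

/-- The incidence graph of `E` together with a disjoint cycle of length `g` and a disjoint star
with `d` leaves. -/
def paddedIncidence (E : ξ → Finset α) (d g : ℕ) :
    SimpleGraph ((α ⊕ ξ) ⊕ (Fin g ⊕ Fin (d + 1))) :=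
  incidence E ⊕g (cycleGraph g ⊕g starGraph 0)

variable {E : ξ → Finset α} {d g : ℕ}

section

variable [Fintype ξ] [DecidableEq α]

theorem IsSparse.egirth_paddedIncidence (hE : IsSparse E d g) (hg : 3 ≤ g) :
    (paddedIncidence E d g).egirth = g := by
  rw [paddedIncidence, egirth_sum, egirth_sum, egirth_cycleGraph hg,
    (isAcyclic_starGraph _).egirth_eq_top, min_top_right, min_eq_right hE.le_egirth]

theorem IsSparse.maxDegree_paddedIncidence [Fintype α] [DecidableRel (paddedIncidence E d g).Adj]
    (hE : IsSparse E d g) (hg : 3 ≤ g) (hd : 2 ≤ d) : (paddedIncidence E d g).maxDegree = d := by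
  classical
  refine le_antisymm (maxDegree_le_of_forall_degree_le _ _ ?_) ?_
  · intro v
    rw [degree_eq_ncard_neighborSet]
    unfold paddedIncidence
    rcases v with (a | x) | (i | i)
    · rw [neighborSet_sum_inl, Set.ncard_image_of_injective _ Sum.inl_injective,
        ncard_neighborSet_incidence_inl]
      exact hE.setDegree_le a
    · rw [neighborSet_sum_inl, Set.ncard_image_of_injective _ Sum.inl_injective,
        ncard_neighborSet_incidence_inr]
      exact hE.card_le x
    · rw [neighborSet_sum_inr, Set.ncard_image_of_injective _ Sum.inr_injective,
        neighborSet_sum_inl, Set.ncard_image_of_injective _ Sum.inl_injective]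
      obtain ⟨n, rfl⟩ := Nat.exists_eq_add_of_le' hg
      rw [← degree_eq_ncard_neighborSet, cycleGraph_degree_three_le]
      exact hd
    · rw [neighborSet_sum_inr, Set.ncard_image_of_injective _ Sum.inr_injective,
        neighborSet_sum_inr, Set.ncard_image_of_injective _ Sum.inr_injective,
        ← degree_eq_ncard_neighborSet]
      have := (starGraph (0 : Fin (d + 1))).degree_lt_card_verts i
      rw [Fintype.card_fin] at this
      omega
  · refine le_trans (le_of_eq ?_) (degree_le_maxDegree _ (.inr (.inr 0)))
    rw [degree_eq_ncard_neighborSet]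
    unfold paddedIncidence
    rw [neighborSet_sum_inr, Set.ncard_image_of_injective _ Sum.inr_injective,
      neighborSet_sum_inr, Set.ncard_image_of_injective _ Sum.inr_injective,
      ← degree_eq_ncard_neighborSet, degree_starGraph_center, Fintype.card_fin,
      Nat.add_sub_cancel]

end

theorem one_le_frugalChromaticNumber {V : Type*} [Finite V] [Nonempty V] (G : SimpleGraph V)
    {β : ℕ} (hβ : 1 ≤ β) : 1 ≤ G.frugalChromaticNumber β := by
  obtain ⟨C, -⟩ := G.frugalColorable_frugalChromaticNumber hβ
  have := (C (Classical.arbitrary V)).isLt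
  omega

/-- If every `s`-set of unsaturated elements meets some member of the family in more than `β`
elements, then each colour of a `β`-frugal colouring occurs fewer than `s` times on these
elements. -/
theorem IsSparse.le_frugalChromaticNumber [Fintype α] [Fintype ξ] [DecidableEq α] {β l s : ℕ}
    (hE : IsSparse E d g) (hβ : 1 ≤ β) (hd : 0 < d) (hs : 0 < s)
    (hα : Fintype.card α = 2 * l * s) (hξ : Fintype.card ξ = l * s)
    (hmeet : ∀ S : Finset α, #S = s → (∀ a ∈ S, setDegree E a < d) → ∃ x, β < #(E x ∩ S)) :
    l ≤ (paddedIncidence E d g).frugalChromaticNumber β := by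
  by_contra! hlt
  obtain ⟨C, hC⟩ := (paddedIncidence E d g).frugalColorable_frugalChromaticNumber hβ
  generalize (paddedIncidence E d g).frugalChromaticNumber β = k at hlt C hC
  have hsat : #{a | d ≤ setDegree E a} ≤ l * s :=
    hξ ▸ Nat.le_of_mul_le_mul_right (card_saturated_mul_le hE.card_le) hd
  have hunsat : l * s ≤ #{a | setDegree E a < d} := by
    have := card_filter_add_card_filter_not (s := (univ : Finset α)) (fun a => setDegree E a < d)
    simp only [not_lt, card_univ, hα] at this
    nlinarith
  obtain ⟨i, -, hi⟩ := exists_lt_card_fiber_of_mul_lt_card_of_maps_to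
    (s := ({a | setDegree E a < d} : Finset α)) (t := (univ : Finset (Fin k)))
    (f := fun a => C (.inl (.inl a))) (n := s) (fun _ _ => mem_univ _) (by
      rw [card_univ, Fintype.card_fin]
      exact (Nat.mul_lt_mul_of_pos_right hlt hs).trans_le hunsat)
  obtain ⟨S, hS, hScard⟩ := exists_subset_card_eq hi.le
  obtain ⟨x, hx⟩ := hmeet S hScard fun a ha => by
    have := hS ha
    simp only [mem_filter, mem_univ, true_and] at this
    exact this.1
  have hsub : (Sum.inl ∘ Sum.inl : α → (α ⊕ ξ) ⊕ (Fin g ⊕ Fin (d + 1))) ''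
      ((E x ∩ S : Finset α) : Set α) ⊆
      {w | (paddedIncidence E d g).Adj (.inl (.inr x)) w ∧ C w = i} := by
    rintro _ ⟨a, ha, rfl⟩
    rw [mem_coe, mem_inter] at ha
    have := hS ha.2
    simp only [mem_filter, mem_univ, true_and] at this
    exact ⟨ha.1, this.2⟩
  have h := (Set.encard_le_encard hsub).trans (hC _ i)
  rw [(Sum.inl_injective.comp Sum.inl_injective).encard_image, Set.encard_coe_eq_coe_finsetCard,
    Nat.cast_le] at h
  omega

end Padding

/-- A graph with the required degree and girth and with frugal chromatic number at least `l`. -/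
theorem exists_le_frugalChromaticNumber {β d g l : ℕ} (hβ : 1 ≤ β) (hd : 2 ≤ d) (hg : 3 ≤ g)
    (hl : 1 ≤ l) (h : Real.log (2 * l) + 1 < l * binomialTail (1 / (4 * l)) (β + 1) d) :
    ∃ (V : Type) (_ : Fintype V) (G : SimpleGraph V) (_ : DecidableRel G.Adj),
      G.maxDegree = d ∧ G.egirth = (g : ℕ∞) ∧ l ≤ G.frugalChromaticNumber β := by
  classical
  obtain ⟨M, hM⟩ : ∃ M, M = (d + 1) ^ g := ⟨_, rfl⟩
  have hM0 : 0 < M := hM ▸ by positivity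
  have hl1 : (1 : ℝ) ≤ l := by exact_mod_cast hl
  have hp0 : (0 : ℝ) ≤ 1 / (4 * l) := by positivity
  have hp1 : 1 / (4 * l : ℝ) ≤ 1 := by
    rw [div_le_one (by positivity)]; linarith
  obtain ⟨E, hE, hmeet⟩ := exists_isSparse_forall_lt_card_inter
    -- With s = 2M and p = 1/(4l), the condition p|α| ≤ s - M is an equality.
    (α := Fin (2 * l * (2 * M))) (ξ := Fin (l * (2 * M)))
    (d := d) (g := g) (s := 2 * M) (β := β) hp0 hp1 (by omega) (by omega) (by
      rw [← hM, Fintype.card_fin]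
      push_cast
      apply le_of_eq
      field_simp
      ring) (by
      rw [Fintype.card_fin, Fintype.card_fin]
      exact choose_mul_one_sub_pow_lt_one hl (by omega) (binomialTail_le_one hp0 hp1 _ _) h)
  exact ⟨_, inferInstance, paddedIncidence E d g, Classical.decRel _,
    hE.maxDegree_paddedIncidence hg hd, hE.egirth_paddedIncidence hg,
    hE.le_frugalChromaticNumber (s := 2 * M) hβ (by omega) (by omega) (by simp) (by simp) hmeet⟩

/-- Serves Δ below the threshold `d₀`, where χ_β ≥ 1 is enough. -/
theorem exists_maxDegree_eq_egirth_eq {d g : ℕ} (hd : 2 ≤ d) (hg : 3 ≤ g) :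
    ∃ (V : Type) (_ : Fintype V) (_ : Nonempty V) (G : SimpleGraph V) (_ : DecidableRel G.Adj),
      G.maxDegree = d ∧ G.egirth = (g : ℕ∞) := by
  classical
  have hE : IsSparse (fun _ : Fin 0 => (∅ : Finset (Fin 0))) d g :=
    ⟨fun a => a.elim0, fun x => x.elim0, by simp [Subsingleton.elim (incidence _) ⊥]⟩
  exact ⟨_, inferInstance, ⟨.inr (.inr 0)⟩, paddedIncidence _ d g, Classical.decRel _,
    hE.maxDegree_paddedIncidence hg hd, hE.egirth_paddedIncidence hg⟩

end SimpleGraph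

theorem theorem3 (β : ℕ) (hβ : 1 ≤ β) :
    ∃ c : ℝ, 0 < c ∧ ∀ Δ g : ℕ, 2 ≤ Δ → 3 ≤ g →
      ∃ (V : Type) (_ : Fintype V) (G : SimpleGraph V) (_ : DecidableRel G.Adj),
        G.maxDegree = Δ ∧ G.egirth = (g : ℕ∞) ∧
          c * ((Δ : ℝ) ^ (1 + 1 / (β : ℝ)) / (Real.log Δ) ^ (1 / (β : ℝ))) ≤
            (G.frugalChromaticNumber β : ℝ) := by
  obtain ⟨c, hc, d₀, h⟩ := exists_log_lt_mul_binomialTail hβ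
  obtain ⟨R, hR⟩ : ∃ R : ℕ → ℝ, ∀ d : ℕ,
      R d = (d : ℝ) ^ (1 + 1 / (β : ℝ)) / (Real.log d) ^ (1 / (β : ℝ)) := ⟨_, fun _ => rfl⟩
  have hR0 : ∀ d, 0 ≤ R d := fun d => by
    rw [hR]
    have := Real.log_natCast_nonneg d
    positivity
  have hsum : 0 ≤ ∑ d ∈ range d₀, R d := sum_nonneg fun d _ => hR0 d
  -- The second term is at most 1/R(Δ) for each of the finitely many Δ < d₀.
  refine ⟨min c (1 + ∑ d ∈ range d₀, R d)⁻¹, lt_min hc (by positivity), fun Δ g hΔ hg => ?_⟩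
  rw [← hR]
  rcases le_or_gt d₀ Δ with hd | hd
  · obtain ⟨l, hl, hle, hlog⟩ := h Δ hd
    obtain ⟨V, i, G, j, h1, h2, h3⟩ := SimpleGraph.exists_le_frugalChromaticNumber hβ hΔ hg hl hlog
    refine ⟨V, i, G, j, h1, h2, ?_⟩
    rw [← hR] at hle
    exact (mul_le_mul_of_nonneg_right (min_le_left _ _) (hR0 Δ)).trans
      (hle.trans (by exact_mod_cast h3))
  · obtain ⟨V, i, _, G, j, h1, h2⟩ := SimpleGraph.exists_maxDegree_eq_egirth_eq hΔ hg
    refine ⟨V, i, G, j, h1, h2, ?_⟩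
    refine (mul_le_mul_of_nonneg_right (min_le_right _ _) (hR0 Δ)).trans
      (le_trans ?_ (by exact_mod_cast G.one_le_frugalChromaticNumber hβ :
        (1 : ℝ) ≤ G.frugalChromaticNumber β))
    rw [inv_mul_le_one₀ (by positivity)]
    have := single_le_sum (fun d _ => hR0 d) (mem_range.2 hd)
    linarith
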